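/- Fix a joint radar-communication node $i$ and a channel $j$ with orthogonal sub-carriers $f_m=f_c+m\Delta f$, $m=1,\dots,M_c$. Let $\mathbf q_b\ne\mathbf q_i$ and $\mathbf q_g\neq \mathbf q_i$ be the locations in $\mathbb R^3$ of the receiver, the node and the jammer, $D_{bi}=\|\mathbf q_b-\mathbf q_i\|$, $D_{gi}=\|\mathbf q_g-\mathbf q_i\|$, with real path loss exponents $\alpha_{bi},\alpha_{gi}$. Let $p^{(T)}_m>0$ be the transmit powers, $p^{(J)}_g>0$ the jamming power, $\sigma_r^2>0$ the noise power, and $T_{\rm pri}=T_{\rm pulse}/\delta$ the pulse repetition interval ($T_{\rm pulse},\delta>0$). For $\alpha,\mu,\bar\gamma>0$ put $\beta=\bar\gamma\,\Gamma(\mu)/\Gamma(\mu+2/\alpha)$; the law $\alpha\text{-}\mu(\alpha,\mu,\bar\gamma)$ has density $\frac{\alpha\gamma^{\alpha\mu/2-1}}{2\beta^{\alpha\mu/2}\Gamma(\mu)}\exp(-(\gamma/\beta)^{\alpha/2})$ on $(0,\infty)$. For every $m$ let the random quantities $|G(f_m)|^2\sim\alpha\text{-}\mu(\alpha_{rm},\mu_{rm},\bar\gamma_{rm})$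 (transmitted signal) and $|J(f_m)|^2\sim\alpha\text{-}\mu(\alpha_{rg},\mu_{rg},\bar\gamma_{rg})$ (jamming signal) be independent, with all parameters positive, and let $\beta_{rm},\beta_{rg}$ be the corresponding values of $\beta$. The random radar mutual information is $$\mathcal I_{ij}=\frac{\Delta f\,T_{\rm pri}}2\sum_{m=1}^{M_c}\log_2\!\left(1+\frac{T_{\rm pri}D_{bi}^{-\alpha_{bi}}p^{(T)}_m|G(f_m)|^2}{\sigma_r^2+D_{gi}^{-\alpha_{gi}}p_g^{(J)}|J(f_m)|^2}\right).$$ Let $C_3=C_3(m)=T_{\rm pri}D_{bi}^{-\alpha_{bi}}p_m^{(T)}$, $C_4=D_{gi}^{-\alpha_{gi}}p_g^{(J)}$, $a_m=\alpha_{rm}\mu_{rm}/2$, $b=\alpha_{rg}\mu_{rg}/2$. Then $\mathcal I_{ij}$ is integrable and the covert radar mutual information rate $I_{ij}=\mathbb E[\mathcal I_{ij}]$ is $$I_{ij}=\sum_{m=1}^{M_c}\frac{\Delta f\,T_{\rm pri}}{\ln 2}\,\frac{\bigl(2(C_4\beta_{rg})^{b}\,\Gamma(\mu_{rg})\bigr)^{-1}}{(C_3\beta_{rm})^{a_m}\,\Gamma(\mu_{rm})}\,(\sigma_r^2)^{a_m+b}\;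 H^{0,1:2,2;1,1}_{1,0:3,3;1,1}\!\left(\begin{matrix}C_3\beta_{rm}/\sigma_r^2\\ C_4\beta_{rg}/\sigma_r^2\end{matrix}\,\middle|\,\begin{matrix}(1+a_m+b:1,1):(1,\tfrac2{\alpha_{rm}})(a_m,1)(1+a_m,1);(1,\tfrac2{\alpha_{rg}})\\ -:(a_m,1)(a_m,1)(1+a_m,1);(b,1)\end{matrix}\right).$$ Here the bivariate Fox $H$-function is the double Mellin–Barnes integral along vertical lines $\mathrm{Re}\,s=\sigma_1$, $\mathrm{Re}\,t=\sigma_2$ which, with $a=a_m$, reads $$H(z_1,z_2)=\frac1{(2\pi i)^2}\int\!\!\int\Gamma(s+t-a-b)\,\frac{\Gamma(\tfrac{2s}{\alpha_{rm}})\Gamma(1-a+s)\Gamma(a-s)^2}{\Gamma(1+a-s)\Gamma(s-a)}\,\Gamma(\tfrac{2t}{\alpha_{rg}})\Gamma(b-t)\,z_1^{s}z_2^{t}\,ds\,dt ,$$ where $a<\sigma_1<a+1$, $0<\sigma_2<b$ and $\sigma_1+\sigma_2>a+b$. Such $\sigma_1,\sigma_2$ exist for every $m$, and for each such choice the double integral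 converges absolutely and the formula holds. -/

import Mathlib

open MeasureTheory ProbabilityTheory

noncomputable section

namespace CovertRadar

/-! ### The alpha-mu distribution -/

/-- The scale parameter `β = γbar Γ(μ) / Γ(μ + 2/α)` of a squared `α-μ` variable of mean `γbar`. -/
def alphaMuScale (α μ γbar : ℝ) : ℝ :=
  γbar * Real.Gamma μ / Real.Gamma (μ + 2 / α)

/-- The probability density function of a squared `α-μ` random variable of mean `γbar`. -/
def alphaMuPDF (α μ γbar x : ℝ) : ℝ :=
  if 0 < x then
    α * x ^ (α * μ / 2 - 1) / (2 * alphaMuScale α μ γbar ^ (α * μ / 2) * Real.Gamma μ)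
      * Real.exp (-(x / alphaMuScale α μ γbar) ^ (α / 2))
  else 0

/-- The law `α-μ(α, μ, γbar)` of a squared `α-μ` random variable. -/
def alphaMuLaw (α μ γbar : ℝ) : Measure ℝ :=
  volume.withDensity fun x => ENNReal.ofReal (alphaMuPDF α μ γbar x)

/-! ### The bivariate Fox H-function -/

/-- The kernel depending on one variable only. The pairs `(c, γ)` of the list `C` form the upper
row and the pairs `(d, δ)` of the list `D` the lower row of the parameter array:
`∏_{j ≤ n} Γ(1 - c_j + γ_j s) ∏_{j ≤ m} Γ(d_j - δ_j s)` divided by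
`∏_{j > n} Γ(c_j - γ_j s) ∏_{j > m} Γ(1 - d_j + δ_j s)`. -/
def foxKernel (m n : ℕ) (C D : List (ℝ × ℝ)) (s : ℂ) : ℂ :=
  (((C.take n).map fun c => Complex.Gamma (1 - (c.1 : ℂ) + (c.2 : ℂ) * s)).prod
      * ((D.take m).map fun d => Complex.Gamma ((d.1 : ℂ) - (d.2 : ℂ) * s)).prod)
    / (((C.drop n).map fun c => Complex.Gamma ((c.1 : ℂ) - (c.2 : ℂ) * s)).prod
      * ((D.drop m).map fun d => Complex.Gamma (1 - (d.1 : ℂ) + (d.2 : ℂ) * s)).prod)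

/-- The kernel coupling both variables. The lists `A`, `B` hold the triples `(a : α, α')` of the
upper row and `(b : β, β')` of the lower row:
`∏_{j ≤ n} Γ(1 - a_j + α_j s + α'_j t)` divided by
`∏_{j > n} Γ(a_j - α_j s - α'_j t) ∏_j Γ(1 - b_j + β_j s + β'_j t)`. -/
def foxJointKernel (n : ℕ) (A B : List (ℝ × ℝ × ℝ)) (s t : ℂ) : ℂ :=
  ((A.take n).map fun a =>
      Complex.Gamma (1 - (a.1 : ℂ) + (a.2.1 : ℂ) * s + (a.2.2 : ℂ) * t)).prod
    / (((A.drop n).map fun a =>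
          Complex.Gamma ((a.1 : ℂ) - (a.2.1 : ℂ) * s - (a.2.2 : ℂ) * t)).prod
      * (B.map fun b =>
          Complex.Gamma (1 - (b.1 : ℂ) + (b.2.1 : ℂ) * s + (b.2.2 : ℂ) * t)).prod)

/-- The Mellin-Barnes integrand of
`H^{0,n : m₁,n₁ ; m₂,n₂}_{p,q : p₁,q₁ ; p₂,q₂}(z₁, z₂ | A : C₁ ; C₂ / B : D₁ ; D₂)`,
where `p, q, p₁, q₁, p₂, q₂` are the lengths of `A, B, C₁, D₁, C₂, D₂`. -/
def foxIntegrand (n m₁ n₁ m₂ n₂ : ℕ) (z₁ z₂ : ℝ) (A B : List (ℝ × ℝ × ℝ))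
    (C₁ D₁ C₂ D₂ : List (ℝ × ℝ)) (s t : ℂ) : ℂ :=
  foxJointKernel n A B s t * foxKernel m₁ n₁ C₁ D₁ s * foxKernel m₂ n₂ C₂ D₂ t
    * (z₁ : ℂ) ^ s * (z₂ : ℂ) ^ t

/-- The bivariate Fox H-function, as the double Mellin-Barnes integral
`(2πi)⁻² ∫∫ (integrand) ds dt` along the vertical lines `Re s = σ₁` and `Re t = σ₂`, each running
from `σ - i∞` to `σ + i∞`. -/
def foxH (σ₁ σ₂ : ℝ) (n m₁ n₁ m₂ n₂ : ℕ) (z₁ z₂ : ℝ) (A B : List (ℝ × ℝ × ℝ))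
    (C₁ D₁ C₂ D₂ : List (ℝ × ℝ)) : ℂ :=
  (1 / (2 * (Real.pi : ℂ) * Complex.I)) ^ 2
    * ∫ u : ℝ, ∫ v : ℝ,
        foxIntegrand n m₁ n₁ m₂ n₂ z₁ z₂ A B C₁ D₁ C₂ D₂
          ((σ₁ : ℂ) + (u : ℂ) * Complex.I) ((σ₂ : ℂ) + (v : ℂ) * Complex.I)
          * Complex.I * Complex.I

/-- The lines `Re s = σ₁`, `Re t = σ₂` are integration paths of the H-function in the mutual
information rate: with `a = α_rm μ_rm / 2` and `b = α_rg μ_rg / 2`, the transform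
`∫₀^∞ log(1+x) x^(a-s-1) dx` (`a < σ₁ < a + 1`), the Mellin-Barnes integral of the exponential
function of the jamming density (`0 < σ₂`) and the Beta integral
`∫₀^∞ x^(b-t-1) (1+x)^(a-s) dx` (`σ₂ < b`, `a + b < σ₁ + σ₂`) all converge. -/
def IsContour (a b σ₁ σ₂ : ℝ) : Prop :=
  a < σ₁ ∧ σ₁ < a + 1 ∧ 0 < σ₂ ∧ σ₂ < b ∧ a + b < σ₁ + σ₂

/-! ### The radar model -/

/-- The frequency `f_m = f_c + m Δf` of the `m`-th sub-carrier. -/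
def subcarrier (fc Δf : ℝ) (m : ℕ) : ℝ := fc + m * Δf

/-- The path loss `D^(-κ)` between two locations at distance `D`, for the exponent `κ`. -/
def pathLoss (x y : EuclideanSpace ℝ (Fin 3)) (κ : ℝ) : ℝ := dist x y ^ (-κ)

/-- The (instantaneous) radar mutual information rate of a channel with sub-carriers
`1, …, Mc`, for the realizations `G`, `J` of the spectra of the transmitted and of the
jamming signal, noise `Ψ`, pulse repetition interval `T`, path losses `Lb`, `Lg`, and transmit and
jamming powers `pT m` and `pJ`. -/
def mutualInfo (Mc : ℕ) (fc Δf T Lb Lg : ℝ) (pT : ℕ → ℝ) (pJ : ℝ)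
    (Ψ : ℝ → ℝ) (G J : ℝ → ℂ) : ℝ :=
  Δf * T / 2 * ∑ m ∈ Finset.Icc 1 Mc,
    Real.logb 2 (1 + T * Lb * pT m * ‖G (subcarrier fc Δf m)‖ ^ 2
      / (Ψ (subcarrier fc Δf m) + Lg * pJ * ‖J (subcarrier fc Δf m)‖ ^ 2))

/-! ### The H-function of the closed form -/

/-- The integrand of the H-function of the closed form, where `a = α_rm μ_rm / 2`,
`b = α_rg μ_rg / 2`. -/
def miIntegrand (αm αg a b z₁ z₂ : ℝ) (s t : ℂ) : ℂ :=
  foxIntegrand 1 2 2 1 1 z₁ z₂ [(1 + a + b, 1, 1)] []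
    [(1, 2 / αm), (a, 1), (1 + a, 1)] [(a, 1), (a, 1), (1 + a, 1)]
    [(1, 2 / αg)] [(b, 1)] s t

/-- `H^{0,1:2,2;1,1}_{1,0:3,3;1,1}` at `(z₁, z₂)` with the parameters of the closed form. -/
def miFoxH (σ₁ σ₂ αm αg a b z₁ z₂ : ℝ) : ℂ :=
  foxH σ₁ σ₂ 1 2 2 1 1 z₁ z₂ [(1 + a + b, 1, 1)] []
    [(1, 2 / αm), (a, 1), (1 + a, 1)] [(a, 1), (a, 1), (1 + a, 1)]
    [(1, 2 / αg)] [(b, 1)]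

end CovertRadar

end

namespace CovertRadar

open Set Filter Topology

/-! ### The Gamma function on vertical lines -/

/-! On one sub-carrier let X = |G|², Y = |J|², S = σ_r². The quotient inside the logarithm couples X
and Y. Frullani's integral log(1 + A/B) = ∫₀^∞ r⁻¹ (1 - e^(-Ar)) e^(-Br) dr with A = C₃X, B = S +
C₄Y separates them, and independence turns the expectation into ∫ r⁻¹ e^(-Sr) E[1 - e^(-C₃rX)]
E[e^(-C₄rY)] dr (`integral_log_one_add_div`).

Each expectation is a Mellin–Parseval integral (`integral_rpow_mul_exp_neg_rpow_mul`): the stretched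
exponential in the density is an inverse Mellin transform of a Gamma function, while 1 - e^(-x) and
e^(-x) have the transforms -Γ and Γ on their strips. Now r enters only through r^(s-a) and r^(t-b),
so the r-integral yields Γ(s+t-a-b) S^(a+b-s-t), the coupling kernel
(`integral_exp_neg_mul_integral_mul_integral`). The Gamma quotient in s collapses to -Γ(a-s)
(`Gamma_quotient_eq`), which identifies the result with the H-function.

Every interchange is absolutely convergent: Γ(2s/α) decays at least quadratically along a vertical
line, and all other factors are bounded there. -/

lemma norm_Gamma_le {s : ℂ} (hs : 0 < s.re) : ‖Complex.Gamma s‖ ≤ Real.Gamma s.re := by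
  rw [Complex.Gamma_eq_integral hs, Real.Gamma_eq_integral hs, Complex.GammaIntegral]
  refine (norm_integral_le_integral_norm _).trans_eq
    (setIntegral_congr_fun measurableSet_Ioi fun x hx => ?_)
  have hx : 0 < x := hx
  simp only [norm_mul, Complex.norm_real, Real.norm_eq_abs, Real.abs_exp]
  rw [Complex.norm_cpow_eq_rpow_re_of_pos hx]
  simp

lemma continuous_Gamma_comp {X : Type*} [TopologicalSpace X] {f : X → ℂ} (hf : Continuous f)
    (h : ∀ x, 0 < (f x).re) : Continuous fun x => Complex.Gamma (f x) := by
  refine continuous_iff_continuousAt.2 fun x => ?_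
  refine ContinuousAt.comp (g := Complex.Gamma) ?_ hf.continuousAt
  refine (Complex.differentiableAt_Gamma _ fun m hm => ?_).continuousAt
  have := h x
  rw [hm] at this
  simp at this
  linarith [(Nat.cast_nonneg m : (0 : ℝ) ≤ m)]

lemma Gamma_eq_Gamma_add_one_div {s : ℂ} (hs : s ≠ 0) :
    Complex.Gamma s = Complex.Gamma (s + 1) / s := by
  rw [Complex.Gamma_add_one s hs, mul_div_cancel_left₀ _ hs]

lemma continuous_Gamma_comp_of_neg {X : Type*} [TopologicalSpace X] {f : X → ℂ}
    (hf : Continuous f) (h : ∀ x, -1 < (f x).re) (h' : ∀ x, (f x).re < 0) :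
    Continuous fun x => Complex.Gamma (f x) := by
  have h0 : ∀ x, f x ≠ 0 := fun x hx => by have := h' x; simp [hx] at this
  simp_rw [fun x => Gamma_eq_Gamma_add_one_div (h0 x)]
  refine (continuous_Gamma_comp (by fun_prop) fun x => ?_).div hf h0
  have := h x
  simp; linarith

lemma norm_Gamma_le_of_neg {s : ℂ} (h : -1 < s.re) (h' : s.re < 0) :
    ‖Complex.Gamma s‖ ≤ Real.Gamma (s.re + 1) / -s.re := by
  have h0 : s ≠ 0 := fun hx => by simp [hx] at h'
  rw [Gamma_eq_Gamma_add_one_div h0, norm_div]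
  have h1 : ‖Complex.Gamma (s + 1)‖ ≤ Real.Gamma (s.re + 1) := by
    have := norm_Gamma_le (s := s + 1) (by simp; linarith)
    simpa using this
  have h2 : -s.re ≤ ‖s‖ := (neg_le_abs _).trans (Complex.abs_re_le_norm s)
  have h3 : 0 < -s.re := by linarith
  have h4 : 0 < Real.Gamma (s.re + 1) := Real.Gamma_pos_of_pos (by linarith)
  gcongr

/-- Two shifts, Γ(s) = Γ(s+2)/(s(s+1)), already give integrable decay, so Stirling's formula is not
needed. The constant comes from min(σ², 1)(1 + u²) ≤ σ² + u² = |s|². -/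
lemma norm_Gamma_line_le {σ : ℝ} (hσ : 0 < σ) (u : ℝ) :
    ‖Complex.Gamma (σ + u * Complex.I)‖ ≤ Real.Gamma (σ + 2) / min (σ ^ 2) 1 * (1 + u ^ 2)⁻¹ := by
  set s : ℂ := σ + u * Complex.I with hs
  have hre : s.re = σ := by simp [hs]
  have him : s.im = u := by simp [hs]
  have h0 : s ≠ 0 := fun h => by simp [h] at hre; linarith
  have h1 : s + 1 ≠ 0 := fun h => by
    have := congrArg Complex.re h
    simp [hre] at this; linarith
  rw [Gamma_eq_Gamma_add_one_div h0, Gamma_eq_Gamma_add_one_div h1, norm_div, norm_div]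
  have hΓ : ‖Complex.Gamma (s + 1 + 1)‖ ≤ Real.Gamma (σ + 2) := by
    have := norm_Gamma_le (s := s + 1 + 1) (by simp [hre]; linarith)
    refine this.trans_eq ?_
    simp [hre]; ring_nf
  have hs2 : ‖s‖ ^ 2 = σ ^ 2 + u ^ 2 := by
    rw [Complex.sq_norm, Complex.normSq_apply, hre, him]; ring
  have hle : ‖s‖ ≤ ‖s + 1‖ := by
    rw [← sq_le_sq₀ (norm_nonneg _) (norm_nonneg _), hs2, Complex.sq_norm, Complex.normSq_apply]
    simp [hre, him]; nlinarith
  have hm : 0 < min (σ ^ 2) 1 := by positivity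
  have hm1 : min (σ ^ 2) 1 * (1 + u ^ 2) ≤ ‖s‖ ^ 2 := by
    rw [hs2]
    nlinarith [min_le_left (σ ^ 2) 1, min_le_right (σ ^ 2) 1, sq_nonneg u]
  have hG : 0 < Real.Gamma (σ + 2) := Real.Gamma_pos_of_pos (by linarith)
  have hsp : 0 < ‖s‖ := norm_pos_iff.2 h0
  calc ‖Complex.Gamma (s + 1 + 1)‖ / ‖s + 1‖ / ‖s‖
      ≤ Real.Gamma (σ + 2) / ‖s‖ / ‖s‖ := by gcongr
    _ = Real.Gamma (σ + 2) / ‖s‖ ^ 2 := by rw [div_div, sq]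
    _ ≤ Real.Gamma (σ + 2) / (min (σ ^ 2) 1 * (1 + u ^ 2)) := by gcongr
    _ = _ := by rw [← div_div, div_eq_mul_inv _ (1 + u ^ 2)]

lemma integrable_Gamma_line {σ : ℝ} (hσ : 0 < σ) :
    Integrable fun u : ℝ => Complex.Gamma (σ + u * Complex.I) := by
  refine Integrable.mono' (integrable_inv_one_add_sq.const_mul _) ?_
    (ae_of_all _ (norm_Gamma_line_le hσ))
  exact (continuous_Gamma_comp (by fun_prop) fun u => by simpa using hσ).aestronglyMeasurable

lemma integrable_Gamma_mul_line {σ k : ℝ} (hσ : 0 < σ) (hk : 0 < k) :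
    Integrable fun u : ℝ => Complex.Gamma (k * (σ + u * Complex.I)) := by
  have := (integrable_Gamma_line (mul_pos hk hσ)).comp_mul_left' hk.ne'
  refine this.congr (ae_of_all _ fun u => ?_)
  simp only
  congr 1; push_cast; ring

/-! ### Mellin transforms of exponential functions -/

lemma hasMellin_exp_neg {w : ℂ} (hw : 0 < w.re) :
    HasMellin (fun x : ℝ => (Real.exp (-x) : ℂ)) w (Complex.Gamma w) := by
  refine ⟨?_, by rw [Complex.Gamma_eq_integral hw, Complex.GammaIntegral_eq_mellin]⟩
  refine (Complex.GammaIntegral_convergent hw).congr (ae_of_all _ fun x => ?_)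
  simp only [smul_eq_mul, mul_comm]

lemma hasMellin_exp_neg_rpow {w : ℂ} {p : ℝ} (hp : 0 < p) (hw : 0 < w.re) :
    HasMellin (fun x : ℝ => (Real.exp (-x ^ p) : ℂ)) w ((p : ℂ)⁻¹ * Complex.Gamma (w / p)) := by
  have hw' : 0 < (w / p).re := by rw [Complex.div_ofReal_re]; positivity
  have h := hasMellin_exp_neg hw'
  refine ⟨(MellinConvergent.comp_rpow (f := fun x : ℝ => (Real.exp (-x) : ℂ)) hp.ne').2 h.1, ?_⟩
  rw [mellin_comp_rpow (fun x : ℝ => (Real.exp (-x) : ℂ)), h.2, abs_of_pos hp, Complex.real_smul]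
  simp

lemma one_sub_exp_neg_nonneg {x : ℝ} (hx : 0 ≤ x) : 0 ≤ 1 - Real.exp (-x) := by
  have : Real.exp (-x) ≤ 1 := Real.exp_le_one_iff.2 (by linarith)
  linarith

lemma one_sub_exp_neg_le (x : ℝ) : 1 - Real.exp (-x) ≤ x := by
  linarith [Real.add_one_le_exp (-x)]

lemma one_sub_exp_neg_le_one (x : ℝ) : 1 - Real.exp (-x) ≤ 1 := by
  linarith [Real.exp_pos (-x)]

/-- Integration by parts against x^w / w gives -Γ(w+1)/w = -Γ(w). The boundary term vanishes at 0
because 1 - e^(-x) ≤ x and Re w > -1, and at ∞ because Re w < 0. -/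
lemma hasMellin_one_sub_exp_neg {w : ℂ} (hw : -1 < w.re) (hw' : w.re < 0) :
    HasMellin (fun x : ℝ => ((1 - Real.exp (-x) : ℝ) : ℂ)) w (-Complex.Gamma w) := by
  have h0 : w ≠ 0 := fun hx => by simp [hx] at hw'
  have hcont : Continuous fun x : ℝ => ((1 - Real.exp (-x) : ℝ) : ℂ) := by fun_prop
  have hnorm : ∀ x : ℝ, 0 < x → ‖((1 - Real.exp (-x) : ℝ) : ℂ)‖ = 1 - Real.exp (-x) :=
    fun x hx => by
      rw [Complex.norm_real, Real.norm_of_nonneg (one_sub_exp_neg_nonneg hx.le)]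
  have hconv : MellinConvergent (fun x : ℝ => ((1 - Real.exp (-x) : ℝ) : ℂ)) w := by
    -- The function is O(1) at infinity and O(x) at zero; these two exponents bound the strip.
    refine mellinConvergent_of_isBigO_rpow (a := 0) (b := -1)
      (hcont.locallyIntegrable.locallyIntegrableOn _) ?_ hw' ?_ hw
    · refine Asymptotics.IsBigO.of_bound 1 ?_
      filter_upwards [eventually_gt_atTop 0] with x hx
      rw [hnorm x hx]
      simpa using Real.exp_nonneg (-x)
    · refine Asymptotics.IsBigO.of_bound 1 ?_
      filter_upwards [self_mem_nhdsWithin] with x hx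
      have hx : 0 < x := hx
      rw [hnorm x hx]
      simp only [neg_neg, Real.rpow_one, one_mul, Real.norm_of_nonneg hx.le]
      exact one_sub_exp_neg_le x
  refine ⟨hconv, ?_⟩
  have hG := hasMellin_exp_neg (w := w + 1) (by simp; linarith)
  have hnormv : ∀ x : ℝ, 0 < x → ‖((1 - Real.exp (-x) : ℝ) : ℂ) * ((x : ℂ) ^ w / w)‖
      = (1 - Real.exp (-x)) * x ^ w.re / ‖w‖ := fun x hx => by
    rw [norm_mul, norm_div, hnorm x hx, Complex.norm_cpow_eq_rpow_re_of_pos hx, mul_div_assoc]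
  have key := integral_Ioi_mul_deriv_eq_deriv_mul (a := (0 : ℝ)) (a' := (0 : ℂ)) (b' := (0 : ℂ))
    (u := fun x : ℝ => ((1 - Real.exp (-x) : ℝ) : ℂ)) (u' := fun x : ℝ => (Real.exp (-x) : ℂ))
    (v := fun x : ℝ => (x : ℂ) ^ w / w) (v' := fun x : ℝ => (x : ℂ) ^ (w - 1))
    (fun x _ => by
      have : HasDerivAt (fun x : ℝ => 1 - Real.exp (-x)) (Real.exp (-x)) x := by
        have := ((hasDerivAt_neg x).exp).const_sub 1
        simpa using this
      exact this.ofReal_comp)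
    (fun x hx => by
      have := hasDerivAt_ofReal_cpow_const' (x := x) (ne_of_gt hx) (r := w - 1)
        (fun h => h0 (by linear_combination h))
      simpa using this)
    (hconv.congr (ae_of_all _ fun x => by simp [mul_comm]))
    (by
      refine (hG.1.div_const w).congr (ae_of_all _ fun x => ?_)
      simp only [smul_eq_mul, add_sub_cancel_right, Pi.mul_apply]
      ring)
    (by
      rw [tendsto_zero_iff_norm_tendsto_zero]
      have hlim : Tendsto (fun x : ℝ => x ^ (w.re + 1) / ‖w‖) (𝓝[>] 0) (𝓝 0) := by
        have : ContinuousAt (fun x : ℝ => x ^ (w.re + 1) / ‖w‖) 0 :=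
          (Real.continuousAt_rpow_const _ _ (Or.inr (by linarith))).div_const _
        have h := this.tendsto
        simp only [Real.zero_rpow (by linarith : w.re + 1 ≠ 0), zero_div] at h
        exact h.mono_left nhdsWithin_le_nhds
      refine squeeze_zero' (.of_forall fun x => norm_nonneg _) ?_ hlim
      filter_upwards [self_mem_nhdsWithin] with x hx
      have hx : 0 < x := hx
      simp only [Pi.mul_apply]
      rw [hnormv x hx, add_comm, Real.rpow_add hx, Real.rpow_one]
      gcongr
      exact one_sub_exp_neg_le x)
    (by
      rw [tendsto_zero_iff_norm_tendsto_zero]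
      have hlim : Tendsto (fun x : ℝ => x ^ w.re / ‖w‖) atTop (𝓝 0) := by
        have := (tendsto_rpow_neg_atTop (y := -w.re) (by linarith)).div_const ‖w‖
        simpa using this
      refine squeeze_zero' (.of_forall fun x => norm_nonneg _) ?_ hlim
      filter_upwards [eventually_gt_atTop 0] with x hx
      simp only [Pi.mul_apply]
      rw [hnormv x hx]
      gcongr
      exact mul_le_of_le_one_left (by positivity) (one_sub_exp_neg_le_one x))
  rw [mellin]
  simp_rw [smul_eq_mul, mul_comm ((_ : ℂ) ^ (w - 1))]
  rw [key, Gamma_eq_Gamma_add_one_div h0, ← hG.2, mellin, sub_self, zero_sub, ← integral_div]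
  congr 1
  refine integral_congr_ae (ae_of_all _ fun x => ?_)
  simp only [smul_eq_mul, add_sub_cancel_right]
  ring

/-! ### Mellin-Barnes representations -/

/-- Mellin inversion, applicable because the transform p⁻¹ Γ(w/p) is integrable on the line. -/
lemma exp_neg_rpow_eq_integral {p σ x : ℝ} (hp : 0 < p) (hσ : 0 < σ) (hx : 0 < x) :
    (Real.exp (-x ^ p) : ℂ) = 1 / (2 * Real.pi) * ∫ u : ℝ,
      (x : ℂ) ^ (-(σ + u * Complex.I))
        * ((p : ℂ)⁻¹ * Complex.Gamma ((p : ℂ)⁻¹ * (σ + u * Complex.I))) := by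
  have hre : ∀ u : ℝ, 0 < ((σ : ℂ) + u * Complex.I).re := fun u => by simpa using hσ
  have hm : ∀ u : ℝ, mellin (fun x : ℝ => (Real.exp (-x ^ p) : ℂ)) (σ + u * Complex.I)
      = (p : ℂ)⁻¹ * Complex.Gamma ((p : ℂ)⁻¹ * (σ + u * Complex.I)) := fun u => by
    rw [(hasMellin_exp_neg_rpow hp (hre u)).2, div_eq_inv_mul]
  have hint := (integrable_Gamma_mul_line hσ (inv_pos.2 hp)).const_mul (p : ℂ)⁻¹
  have h := mellinInv_mellin_eq σ (fun x : ℝ => (Real.exp (-x ^ p) : ℂ)) hx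
    (hasMellin_exp_neg_rpow hp (w := σ) (by simpa using hσ)).1
    (by
      refine hint.congr (ae_of_all _ fun u => ?_)
      simp only [hm]
      push_cast
      rfl)
    (by
      have : ContinuousAt (fun x : ℝ => x ^ p) x := Real.continuousAt_rpow_const _ _ (Or.inr hp.le)
      fun_prop)
  rw [← h, mellinInv, Complex.real_smul]
  simp_rw [hm, smul_eq_mul]
  push_cast
  rfl

lemma norm_ofReal_cpow_mul_I {x : ℝ} (hx : 0 < x) (u : ℝ) :
    ‖(x : ℂ) ^ ((u : ℂ) * Complex.I)‖ = 1 := by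
  rw [Complex.norm_cpow_eq_rpow_re_of_pos hx]; simp

/-- Splits off a unimodular phase, so that absolute values in the Fubini arguments do not depend on
the position along the line. -/
lemma cpow_add_mul_I {x : ℝ} (hx : 0 < x) (c : ℂ) (u : ℝ) :
    (x : ℂ) ^ (c + u * Complex.I) = (x : ℂ) ^ c * (x : ℂ) ^ ((u : ℂ) * Complex.I) :=
  Complex.cpow_add _ _ (Complex.ofReal_ne_zero.2 hx.ne')

lemma ae_fst_pos {β : Type*} [MeasurableSpace β] (ν : Measure β) :
    ∀ᵐ z : ℝ × β ∂((volume.restrict (Ioi 0)).prod ν), 0 < z.1 :=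
  Measure.quasiMeasurePreserving_fst.ae (ae_restrict_mem measurableSet_Ioi)

lemma integrable_mul_cpow_line {K : ℝ → ℂ} (hK : Integrable K) {x : ℝ} (hx : 0 < x) (c : ℂ) :
    Integrable fun u : ℝ => K u * (x : ℂ) ^ (c + u * Complex.I) := by
  refine hK.mul_bdd (c := ‖(x : ℂ) ^ c‖) ?_ (ae_of_all _ fun u => ?_)
  · refine (continuous_const.cpow (by fun_prop) fun u => ?_).aestronglyMeasurable
    exact Complex.ofReal_mem_slitPlane.2 hx
  · rw [cpow_add_mul_I hx, norm_mul, norm_ofReal_cpow_mul_I hx, mul_one]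

/-- Mellin-Barnes (Parseval) representation of the integral of `g` against
`x ^ (a - 1) exp (-(x / β) ^ p)`. -/
theorem integral_rpow_mul_exp_neg_rpow_mul {p β σ a : ℝ} (hp : 0 < p) (hβ : 0 < β) (hσ : 0 < σ)
    {g : ℝ → ℂ} (hg : MellinConvergent g ((a : ℂ) - σ)) :
    ∫ x in Ioi (0 : ℝ), ((x ^ (a - 1) * Real.exp (-(x / β) ^ p) : ℝ) : ℂ) * g x
      = 1 / (2 * Real.pi) * ∫ u : ℝ,
        (p : ℂ)⁻¹ * Complex.Gamma ((p : ℂ)⁻¹ * (σ + u * Complex.I))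
          * (β : ℂ) ^ ((σ : ℂ) + u * Complex.I) * mellin g ((a : ℂ) - (σ + u * Complex.I)) := by
  set K : ℝ → ℂ := fun u => (p : ℂ)⁻¹ * Complex.Gamma ((p : ℂ)⁻¹ * (σ + u * Complex.I))
    * (β : ℂ) ^ ((σ : ℂ) + u * Complex.I) with hK
  have hKint : Integrable K := by
    have := (integrable_Gamma_mul_line hσ (inv_pos.2 hp)).const_mul (p : ℂ)⁻¹
    push_cast at this
    exact integrable_mul_cpow_line this hβ _
  set F : ℝ → ℝ → ℂ := fun x u => K u * ((x : ℂ) ^ ((a : ℂ) - (σ + u * Complex.I) - 1) * g x)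
    with hF
  have hFint : Integrable (Function.uncurry F) ((volume.restrict (Ioi 0)).prod volume) := by
    have h1 := Integrable.mul_prod hg hKint
    -- Up to the phase x^(-iu), the double integrand is a product of an integrable function of x and
    -- one of u.
    have h2 := h1.bdd_mul (c := 1) (f := fun z : ℝ × ℝ => (z.1 : ℂ) ^ (((-z.2 : ℝ) : ℂ) * Complex.I))
      (by
        refine Measurable.aestronglyMeasurable ?_
        fun_prop)
      ((ae_fst_pos _).mono fun z hz => (norm_ofReal_cpow_mul_I hz _).le)
    refine h2.congr ?_
    filter_upwards [ae_fst_pos _] with z hz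
    simp only [Function.uncurry, hF, smul_eq_mul]
    rw [show (a : ℂ) - (σ + z.2 * Complex.I) - 1 = (a - σ - 1) + ((-z.2 : ℝ) : ℂ) * Complex.I by
      push_cast; ring, cpow_add_mul_I hz]
    ring
  calc ∫ x in Ioi (0 : ℝ), ((x ^ (a - 1) * Real.exp (-(x / β) ^ p) : ℝ) : ℂ) * g x
      = ∫ x in Ioi (0 : ℝ), 1 / (2 * Real.pi) * ∫ u : ℝ, F x u := by
        refine setIntegral_congr_fun measurableSet_Ioi fun x hx => ?_
        have hx : 0 < x := hx
        rw [Complex.ofReal_mul, exp_neg_rpow_eq_integral hp hσ (div_pos hx hβ), mul_left_comm,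
          mul_assoc]
        congr 1
        rw [← integral_const_mul, ← integral_mul_const]
        refine integral_congr_ae (ae_of_all _ fun u => ?_)
        simp only [hF, hK]
        have hβ0 : (β : ℂ) ≠ 0 := Complex.ofReal_ne_zero.2 hβ.ne'
        have hx0 : (x : ℂ) ≠ 0 := Complex.ofReal_ne_zero.2 hx.ne'
        rw [show (a : ℂ) - (σ + u * Complex.I) - 1 = (a - 1) + -(σ + u * Complex.I) by ring,
          Complex.cpow_add _ _ hx0, Complex.ofReal_cpow hx.le, div_eq_mul_inv,
          Complex.ofReal_mul, Complex.mul_cpow_ofReal_nonneg hx.le (inv_pos.2 hβ).le,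
          Complex.ofReal_inv, Complex.inv_cpow_eq_ite, if_neg, ← Complex.cpow_neg, neg_neg]
        · push_cast; ring
        · rw [Complex.arg_ofReal_of_nonneg hβ.le]; exact Real.pi_pos.ne
    _ = 1 / (2 * Real.pi) * ∫ u : ℝ, ∫ x in Ioi (0 : ℝ), F x u := by
        rw [integral_const_mul, integral_integral_swap hFint]
    _ = _ := by
        congr 1
        refine integral_congr_ae (ae_of_all _ fun u => ?_)
        simp only [hF]
        rw [integral_const_mul]
        rfl

/-! ### Laplace integral of a product of two inverse Mellin transforms -/

/-- The coupling factor is bounded, since |Γ(d + iy)| ≤ Γ(d) and the power of S has constant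
modulus; integrability comes from A and B alone. -/
lemma integrable_mul_Gamma_mul_cpow {A B : ℝ → ℂ} (hA : Integrable A) (hB : Integrable B)
    {d S : ℝ} (hd : 0 < d) (hS : 0 < S) :
    Integrable fun z : ℝ × ℝ => A z.1 * B z.2
      * (Complex.Gamma (d + ((z.1 + z.2 : ℝ) : ℂ) * Complex.I)
        * (S : ℂ) ^ (-d + ((-(z.1 + z.2) : ℝ) : ℂ) * Complex.I)) := by
  refine (hA.mul_prod hB).mul_bdd (c := Real.Gamma d * ‖(S : ℂ) ^ (-d : ℂ)‖) ?_
    (ae_of_all _ fun z => ?_)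
  · refine Continuous.aestronglyMeasurable (Continuous.mul ?_ ?_)
    · exact continuous_Gamma_comp (by fun_prop) fun z => by simpa using hd
    · exact continuous_const.cpow (by fun_prop) fun u => Complex.ofReal_mem_slitPlane.2 hS
  · rw [norm_mul, cpow_add_mul_I hS, norm_mul, norm_ofReal_cpow_mul_I hS, mul_one]
    have := norm_Gamma_le (s := d + ((z.1 + z.2 : ℝ) : ℂ) * Complex.I) (by simpa using hd)
    simp only [Complex.add_re, Complex.ofReal_re, Complex.re_ofReal_mul, Complex.I_re, mul_zero,
      add_zero] at this
    gcongr

/-- After Fubini the inner integral is Euler's integral of r^(d-1+i(u+v)) e^(-Sr) with d = d₁ + d₂;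
the condition d > 0 is its convergence at r = 0. On the contour it reads σ₁ + σ₂ > a + b. -/
theorem integral_exp_neg_mul_integral_mul_integral {A B : ℝ → ℂ} (hA : Integrable A)
    (hB : Integrable B) {d₁ d₂ S : ℝ} (hd : 0 < d₁ + d₂) (hS : 0 < S) :
    ∫ r in Ioi (0 : ℝ), ((r⁻¹ * Real.exp (-(S * r)) : ℝ) : ℂ)
        * ((∫ u : ℝ, A u * (r : ℂ) ^ ((d₁ : ℂ) + u * Complex.I))
          * ∫ v : ℝ, B v * (r : ℂ) ^ ((d₂ : ℂ) + v * Complex.I))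
      = ∫ u : ℝ, ∫ v : ℝ, A u * B v
        * (Complex.Gamma ((d₁ + d₂ : ℝ) + ((u + v : ℝ) : ℂ) * Complex.I)
          * (S : ℂ) ^ (-((d₁ + d₂ : ℝ) : ℂ) + ((-(u + v) : ℝ) : ℂ) * Complex.I)) := by
  set F : ℝ → ℝ × ℝ → ℂ := fun r z => A z.1 * B z.2
    * ((r : ℂ) ^ (((d₁ + d₂ : ℝ) : ℂ) + ((z.1 + z.2 : ℝ) : ℂ) * Complex.I - 1)
      * Complex.exp (-(S * r))) with hF
  have hreal : Integrable (fun r : ℝ => (r : ℂ) ^ (((d₁ + d₂ : ℝ) : ℂ) - 1)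
      * Complex.exp (-(S * r))) (volume.restrict (Ioi 0)) := by
    have h := (MellinConvergent.comp_mul_left (f := fun x : ℝ => (Real.exp (-x) : ℂ)) hS).2
      (hasMellin_exp_neg (w := ((d₁ + d₂ : ℝ) : ℂ)) (by simpa using hd)).1
    refine Integrable.congr h (ae_of_all _ fun r => ?_)
    simp
  have hFint : Integrable (Function.uncurry F)
      ((volume.restrict (Ioi 0)).prod (volume.prod volume)) := by
    have h1 := hreal.mul_prod (hA.mul_prod hB)
    -- The phase r^(i(u+v)), left out of `hreal`, is restored as a factor of modulus one.
    have h2 := h1.bdd_mul (c := 1)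
      (f := fun z : ℝ × ℝ × ℝ => (z.1 : ℂ) ^ (((z.2.1 + z.2.2 : ℝ) : ℂ) * Complex.I))
      (by
        refine Measurable.aestronglyMeasurable ?_
        fun_prop)
      ((ae_fst_pos _).mono fun z hz => (norm_ofReal_cpow_mul_I hz _).le)
    refine h2.congr ?_
    filter_upwards [ae_fst_pos _] with z hz
    simp only [Function.uncurry, hF]
    rw [add_sub_right_comm, cpow_add_mul_I hz]
    ring
  calc _ = ∫ r in Ioi (0 : ℝ), ∫ z : ℝ × ℝ, F r z := by
        refine setIntegral_congr_fun measurableSet_Ioi fun r hr => ?_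
        have hr : 0 < r := hr
        have hr0 : (r : ℂ) ≠ 0 := Complex.ofReal_ne_zero.2 hr.ne'
        rw [← integral_prod_mul, ← integral_const_mul]
        refine integral_congr_ae (ae_of_all _ fun z => ?_)
        simp only [hF]
        rw [show ((d₁ + d₂ : ℝ) : ℂ) + ((z.1 + z.2 : ℝ) : ℂ) * Complex.I - 1
          = (d₁ + z.1 * Complex.I) + (d₂ + z.2 * Complex.I) - 1 by push_cast; ring,
          Complex.cpow_sub _ _ hr0, Complex.cpow_add (d₁ + z.1 * Complex.I) _ hr0, Complex.cpow_one]
        push_cast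
        ring
    _ = ∫ z : ℝ × ℝ, ∫ r in Ioi (0 : ℝ), F r z := integral_integral_swap hFint
    _ = ∫ z : ℝ × ℝ, A z.1 * B z.2
        * (Complex.Gamma ((d₁ + d₂ : ℝ) + ((z.1 + z.2 : ℝ) : ℂ) * Complex.I)
          * (S : ℂ) ^ (-((d₁ + d₂ : ℝ) : ℂ) + ((-(z.1 + z.2) : ℝ) : ℂ) * Complex.I)) := by
        refine integral_congr_ae (ae_of_all _ fun z => ?_)
        simp only [hF]
        rw [integral_const_mul, Complex.integral_cpow_mul_exp_neg_mul_Ioi (by simpa using hd)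
          (by simpa using hS), one_div, Complex.inv_cpow_eq_ite, if_neg, ← Complex.cpow_neg]
        · rw [mul_comm (Complex.Gamma _)]
          push_cast
          ring_nf
        · rw [Complex.arg_ofReal_of_nonneg hS.le]; exact Real.pi_pos.ne
    _ = _ := by
        rw [Measure.volume_eq_prod, integral_prod _ (integrable_mul_Gamma_mul_cpow hA hB hd hS)]

/-- The factor of a Mellin-Barnes integrand along `Re s = σ` that arises from the density
`x ^ (a - 1) exp (-(x / β) ^ p)` and a function with Mellin transform `h`, scaled by `c`. -/
noncomputable def lineFactor (p β c σ a : ℝ) (h : ℂ → ℂ) (u : ℝ) : ℂ :=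
  (p : ℂ)⁻¹ * Complex.Gamma ((p : ℂ)⁻¹ * (σ + u * Complex.I))
    * (β : ℂ) ^ ((σ : ℂ) + u * Complex.I) * (c : ℂ) ^ (((σ - a : ℝ) : ℂ) + u * Complex.I)
    * h ((a : ℂ) - (σ + u * Complex.I))

/-- All decay comes from Γ(s/p): the powers have constant modulus on the line, so boundedness of h
suffices. -/
lemma integrable_lineFactor {p β c σ a M : ℝ} {h : ℂ → ℂ} (hp : 0 < p) (hβ : 0 < β) (hc : 0 < c)
    (hσ : 0 < σ) (hcont : Continuous fun u : ℝ => h ((a : ℂ) - (σ + u * Complex.I)))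
    (hM : ∀ u : ℝ, ‖h ((a : ℂ) - (σ + u * Complex.I))‖ ≤ M) :
    Integrable (lineFactor p β c σ a h) := by
  have := (integrable_Gamma_mul_line hσ (inv_pos.2 hp)).const_mul (p : ℂ)⁻¹
  push_cast at this
  exact (integrable_mul_cpow_line (integrable_mul_cpow_line this hβ _) hc _).mul_bdd
    hcont.aestronglyMeasurable (ae_of_all _ hM)

/-- Dilating g by c r multiplies its Mellin transform at w by (c r)^(-w). The power of c is absorbed
into `lineFactor`; that of r is kept apart for the later integration over r. -/
lemma integral_rpow_mul_exp_neg_rpow_mul_comp {p β c σ a : ℝ} {h : ℂ → ℂ} {g : ℝ → ℂ}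
    (hp : 0 < p) (hβ : 0 < β) (hc : 0 < c) (hσ : 0 < σ)
    (hg : ∀ w : ℂ, w.re = a - σ → HasMellin g w (h w)) {r : ℝ} (hr : 0 < r) :
    ∫ x in Ioi (0 : ℝ), ((x ^ (a - 1) * Real.exp (-(x / β) ^ p) : ℝ) : ℂ) * g (c * r * x)
      = 1 / (2 * Real.pi) * ∫ u : ℝ, lineFactor p β c σ a h u
        * (r : ℂ) ^ (((σ - a : ℝ) : ℂ) + u * Complex.I) := by
  have hcr : 0 < c * r := mul_pos hc hr
  rw [integral_rpow_mul_exp_neg_rpow_mul (g := fun x => g (c * r * x)) hp hβ hσ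
    ((MellinConvergent.comp_mul_left hcr).2 (hg _ (by simp)).1)]
  congr 1
  refine integral_congr_ae (ae_of_all _ fun u => ?_)
  simp only [lineFactor]
  rw [mellin_comp_mul_left _ _ hcr, (hg _ (by simp)).2, Complex.ofReal_mul,
    Complex.mul_cpow_ofReal_nonneg hc.le hr.le, smul_eq_mul,
    show -((a : ℂ) - (σ + u * Complex.I)) = ((σ - a : ℝ) : ℂ) + u * Complex.I by push_cast; ring]
  ring

/-! ### The alpha-mu law -/

lemma alphaMuScale_pos {α μ γ : ℝ} (hα : 0 < α) (hμ : 0 < μ) (hγ : 0 < γ) :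
    0 < alphaMuScale α μ γ := by
  have h1 := Real.Gamma_pos_of_pos hμ
  have h2 : 0 < Real.Gamma (μ + 2 / α) := Real.Gamma_pos_of_pos (by positivity)
  unfold alphaMuScale
  positivity

lemma alphaMuPDF_nonneg {α μ γ : ℝ} (hα : 0 < α) (hμ : 0 < μ) (hγ : 0 < γ) (x : ℝ) :
    0 ≤ alphaMuPDF α μ γ x := by
  have h1 := Real.Gamma_pos_of_pos hμ
  have h2 := alphaMuScale_pos hα hμ hγ
  unfold alphaMuPDF
  split_ifs <;> positivity

lemma measurable_alphaMuPDF (α μ γ : ℝ) : Measurable (alphaMuPDF α μ γ) := by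
  unfold alphaMuPDF
  refine Measurable.ite measurableSet_Ioi ?_ measurable_const
  fun_prop

lemma alphaMuPDF_eq_indicator (α μ γ x : ℝ) :
    alphaMuPDF α μ γ x = (Ioi (0 : ℝ)).indicator
      (fun x => α / (2 * alphaMuScale α μ γ ^ (α * μ / 2) * Real.Gamma μ)
        * (x ^ (α * μ / 2 - 1) * Real.exp (-(x / alphaMuScale α μ γ) ^ (α / 2)))) x := by
  unfold alphaMuPDF
  by_cases hx : 0 < x
  · rw [if_pos hx, indicator_of_mem (mem_Ioi.2 hx)]; ring
  · rw [if_neg hx, indicator_of_notMem (by simpa using hx)]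

lemma integral_alphaMuLaw {α μ γ : ℝ} (hα : 0 < α) (hμ : 0 < μ) (hγ : 0 < γ) (g : ℝ → ℂ) :
    ∫ x, g x ∂alphaMuLaw α μ γ
      = ((α / (2 * alphaMuScale α μ γ ^ (α * μ / 2) * Real.Gamma μ) : ℝ) : ℂ)
        * ∫ x in Ioi (0 : ℝ), ((x ^ (α * μ / 2 - 1)
          * Real.exp (-(x / alphaMuScale α μ γ) ^ (α / 2)) : ℝ) : ℂ) * g x := by
  rw [alphaMuLaw, integral_withDensity_eq_integral_toReal_smul
    (measurable_alphaMuPDF α μ γ).ennreal_ofReal (ae_of_all _ fun _ => ENNReal.ofReal_lt_top),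
    ← integral_const_mul, ← integral_indicator measurableSet_Ioi]
  refine integral_congr_ae (ae_of_all _ fun x => ?_)
  simp only
  rw [ENNReal.toReal_ofReal (alphaMuPDF_nonneg hα hμ hγ x), alphaMuPDF_eq_indicator]
  by_cases hx : x ∈ Ioi (0 : ℝ)
  · simp only [indicator_of_mem hx, Complex.real_smul]
    push_cast
    ring
  · simp [indicator_of_notMem hx]

lemma integrable_id_alphaMuLaw {α μ γ : ℝ} (hα : 0 < α) (hμ : 0 < μ) (hγ : 0 < γ) :
    Integrable (fun x => x) (alphaMuLaw α μ γ) := by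
  have hβ := alphaMuScale_pos hα hμ hγ
  rw [alphaMuLaw, integrable_withDensity_iff_integrable_smul'
    (measurable_alphaMuPDF α μ γ).ennreal_ofReal (ae_of_all _ fun _ => ENNReal.ofReal_lt_top)]
  -- Up to constants, x times the density is the Mellin integrand of the dilated stretched
  -- exponential at the point a + 1.
  have h := ((MellinConvergent.comp_mul_left (f := fun x : ℝ => (Real.exp (-x ^ (α / 2)) : ℂ))
    (s := ((α * μ / 2 + 1 : ℝ) : ℂ)) (inv_pos.2 hβ)).2 (hasMellin_exp_neg_rpow (by positivity)
      (by rw [Complex.ofReal_re]; positivity)).1).norm.const_mul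
        (α / (2 * alphaMuScale α μ γ ^ (α * μ / 2) * Real.Gamma μ))
  rw [← IntegrableOn, ← integrable_indicator_iff measurableSet_Ioi] at h
  refine h.congr (ae_of_all _ fun x => ?_)
  simp only
  rw [ENNReal.toReal_ofReal (alphaMuPDF_nonneg hα hμ hγ x), alphaMuPDF_eq_indicator]
  by_cases hx : x ∈ Ioi (0 : ℝ)
  · have hx' : 0 < x := hx
    simp only [indicator_of_mem hx, smul_eq_mul, norm_mul, Complex.norm_real, Real.norm_eq_abs,
      Real.abs_exp]
    rw [Complex.norm_cpow_eq_rpow_re_of_pos hx', Complex.sub_re, Complex.ofReal_re,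
      Complex.one_re, add_sub_cancel_right, Real.rpow_sub_one hx'.ne', div_eq_inv_mul x]
    field_simp
  · simp [indicator_of_notMem hx]

/-! ### Frullani's integral for the logarithm -/

lemma integrableOn_inv_mul_one_sub_exp_mul_exp {A B : ℝ} (hA : 0 ≤ A) (hB : 0 < B) :
    IntegrableOn (fun r : ℝ => r⁻¹ * ((1 - Real.exp (-(A * r))) * Real.exp (-(B * r)))) (Ioi 0) := by
  have h : IntegrableOn (fun r : ℝ => A * Real.exp (-B * r)) (Ioi 0) :=
    (exp_neg_integrableOn_Ioi 0 hB).const_mul A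
  refine Integrable.mono' h (Measurable.aestronglyMeasurable (by fun_prop)) ?_
  filter_upwards [ae_restrict_mem measurableSet_Ioi] with r hr
  have hr : 0 < r := hr
  have h0 := one_sub_exp_neg_nonneg (mul_nonneg hA hr.le)
  rw [Real.norm_of_nonneg (by positivity), ← mul_assoc, neg_mul]
  gcongr
  rw [inv_mul_le_iff₀ hr, mul_comm r]
  exact one_sub_exp_neg_le _

/-- The integrand is r⁻¹ (e^(-Br) - e^(-(A+B)r)), so Frullani's formula for e^(-x), with limits 1 at
zero and 0 at infinity, applies. -/
lemma integral_inv_mul_one_sub_exp_mul_exp {A B : ℝ} (hA : 0 ≤ A) (hB : 0 < B) :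
    ∫ r in Ioi (0 : ℝ), r⁻¹ * ((1 - Real.exp (-(A * r))) * Real.exp (-(B * r)))
      = Real.log (1 + A / B) := by
  have heq : ∀ r : ℝ, r⁻¹ * ((1 - Real.exp (-(A * r))) * Real.exp (-(B * r)))
      = r⁻¹ • (Real.exp (-(B * r)) - Real.exp (-((B + A) * r))) := fun r => by
    rw [smul_eq_mul, one_sub_mul, ← Real.exp_add]
    ring_nf
  have hcont : Continuous fun x : ℝ => Real.exp (-x) := by fun_prop
  have hint := integrableOn_inv_mul_one_sub_exp_mul_exp hA hB
  simp_rw [heq] at hint ⊢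
  rw [Frullani.integral_Ioi_eq (f := fun x => Real.exp (-x)) (L := 1) (R := 0)
    (hcont.locallyIntegrable.locallyIntegrableOn _) hB (by positivity : 0 < B + A) ?_ ?_ hint]
  · rw [sub_zero, smul_eq_mul, mul_one]
    congr 1; field_simp
  · have := hcont.tendsto 0
    simp only [neg_zero, Real.exp_zero] at this
    exact this.mono_left nhdsWithin_le_nhds
  · exact Real.tendsto_exp_neg_atTop_nhds_zero

/-! ### The integrand of the H-function -/

/-- The factor of the integrand that depends on `s` only. -/
noncomputable def signalFactor (p β c σ a : ℝ) : ℝ → ℂ :=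
  lineFactor p β c σ a fun w => -Complex.Gamma w

/-- The factor of the integrand that depends on `t` only. -/
noncomputable def jammingFactor (q β c σ b : ℝ) : ℝ → ℂ :=
  lineFactor q β c σ b Complex.Gamma

lemma integrable_signalFactor {p β c σ a : ℝ} (hp : 0 < p) (hβ : 0 < β) (hc : 0 < c)
    (hσ : 0 < σ) (h : a < σ) (h' : σ < a + 1) : Integrable (signalFactor p β c σ a) := by
  have hre : ∀ u : ℝ, ((a : ℂ) - (σ + u * Complex.I)).re = a - σ := fun u => by simp
  refine integrable_lineFactor (M := Real.Gamma (a - σ + 1) / -(a - σ)) hp hβ hc hσ ?_ fun u => ?_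
  · refine (continuous_Gamma_comp_of_neg (by fun_prop) (fun u => ?_) fun u => ?_).neg
    · rw [hre]; linarith
    · rw [hre]; linarith
  · rw [norm_neg, ← hre u]
    refine norm_Gamma_le_of_neg ?_ ?_
    · rw [hre]; linarith
    · rw [hre]; linarith

lemma integrable_jammingFactor {q β c σ b : ℝ} (hq : 0 < q) (hβ : 0 < β) (hc : 0 < c)
    (hσ : 0 < σ) (h : σ < b) : Integrable (jammingFactor q β c σ b) := by
  have hre : ∀ u : ℝ, ((b : ℂ) - (σ + u * Complex.I)).re = b - σ := fun u => by simp
  refine integrable_lineFactor (M := Real.Gamma (b - σ)) hq hβ hc hσ ?_ fun u => ?_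
  · refine continuous_Gamma_comp (by fun_prop) fun u => ?_
    rw [hre]; linarith
  · rw [← hre u]
    refine norm_Gamma_le ?_
    rw [hre]; linarith

/-- The recurrence at s - a and at a - s cancels all Gamma factors but one, with (s-a)/(a-s) = -1
giving the sign. The strip keeps the cancelled factors finite and nonzero. -/
lemma Gamma_quotient_eq {a s : ℂ} (h1 : a.re < s.re) (h2 : s.re < a.re + 1) :
    Complex.Gamma (1 - a + s) * (Complex.Gamma (a - s) * Complex.Gamma (a - s))
      / (Complex.Gamma (1 + a - s) * Complex.Gamma (1 - (1 + a) + s)) = -Complex.Gamma (a - s) := by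
  have h0 : s - a ≠ 0 := fun h => by
    have := congrArg Complex.re h
    simp at this; linarith
  have h0' : a - s ≠ 0 := fun h => h0 (by linear_combination -h)
  have hG1 : Complex.Gamma (s - a) ≠ 0 := Complex.Gamma_ne_zero_of_re_pos (by simp; linarith)
  have hG2 : Complex.Gamma (a - s + 1) ≠ 0 := Complex.Gamma_ne_zero_of_re_pos (by simp; linarith)
  rw [Complex.Gamma_add_one _ h0'] at hG2
  rw [show 1 - a + s = (s - a) + 1 by ring, Complex.Gamma_add_one _ h0,
    show 1 + a - s = (a - s) + 1 by ring, Complex.Gamma_add_one _ h0',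
    show 1 - (1 + a) + s = s - a by ring, div_eq_iff (mul_ne_zero hG2 hG1)]
  ring

/-- Pure algebra, stated for free variables so that no Gamma values or complex powers are unfolded;
S and S' stand for S^(-(a+b)) and S^(a+b). -/
lemma factor_rearrange {p q C₁ C₂ S S' : ℂ} (hp : p ≠ 0) (hq : q ≠ 0) (hC₁ : C₁ ≠ 0)
    (hC₂ : C₂ ≠ 0) (hS : S * S' = 1) {x₁ x₂ x₃ x₄ x₅ x₆ x₇ x₈ x₉ y₁ y₂ : ℂ} :
    x₁ * (x₂ * x₃) * (x₄ * x₅) * (x₆ * x₇ * y₁) * (x₈ * x₉ * y₂)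
      = p * q * C₁ * C₂ * S * (p⁻¹ * x₂ * x₇ * (x₆ / C₁) * x₃ * (q⁻¹ * x₄ * x₉ * (x₈ / C₂) * x₅)
        * (x₁ * (S' * (y₁ * y₂)))) := by
  have hpp := mul_inv_cancel₀ hp
  have hqq := mul_inv_cancel₀ hq
  have h1 := mul_inv_cancel₀ hC₁
  have h2 := mul_inv_cancel₀ hC₂
  calc _ = 1 * 1 * 1 * 1 * 1 * (x₁ * (x₂ * x₃) * (x₄ * x₅) * (x₆ * x₇ * y₁) * (x₈ * x₉ * y₂)) := by
        ring
    _ = (p * p⁻¹) * (q * q⁻¹) * (C₁ * C₁⁻¹) * (C₂ * C₂⁻¹) * (S * S')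
        * (x₁ * (x₂ * x₃) * (x₄ * x₅) * (x₆ * x₇ * y₁) * (x₈ * x₉ * y₂)) := by
        rw [hpp, hqq, h1, h2, hS]
    _ = _ := by rw [div_eq_mul_inv, div_eq_mul_inv]; ring

/-- On the contour the integrand becomes a constant times a function of u, a function of v and the
coupling factor in u + v: the shape produced by the Laplace-type integral over r. -/
lemma miIntegrand_eq {αm αg a b βm βg c₁ c₂ S σ₁ σ₂ : ℝ} (hαm : 0 < αm) (hαg : 0 < αg)
    (hβm : 0 < βm) (hβg : 0 < βg) (hc₁ : 0 < c₁) (hc₂ : 0 < c₂) (hS : 0 < S)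
    (h1 : a < σ₁) (h2 : σ₁ < a + 1) (u v : ℝ) :
    miIntegrand αm αg a b (c₁ * βm / S) (c₂ * βg / S)
        ((σ₁ : ℂ) + (u : ℂ) * Complex.I) ((σ₂ : ℂ) + (v : ℂ) * Complex.I)
      = ((αm / 2 * (αg / 2) * c₁ ^ a * c₂ ^ b * S ^ (-(a + b)) : ℝ) : ℂ)
        * (signalFactor (αm / 2) βm c₁ σ₁ a u * jammingFactor (αg / 2) βg c₂ σ₂ b v
          * (Complex.Gamma (((σ₁ - a) + (σ₂ - b) : ℝ) + ((u + v : ℝ) : ℂ) * Complex.I)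
            * (S : ℂ) ^ (-(((σ₁ - a) + (σ₂ - b) : ℝ) : ℂ)
              + ((-(u + v) : ℝ) : ℂ) * Complex.I))) := by
  set s : ℂ := (σ₁ : ℂ) + (u : ℂ) * Complex.I with hs
  set t : ℂ := (σ₂ : ℂ) + (v : ℂ) * Complex.I with ht
  have hS0 : (S : ℂ) ≠ 0 := Complex.ofReal_ne_zero.2 hS.ne'
  have hc10 : (c₁ : ℂ) ≠ 0 := Complex.ofReal_ne_zero.2 hc₁.ne'
  have hc20 : (c₂ : ℂ) ≠ 0 := Complex.ofReal_ne_zero.2 hc₂.ne'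
  have hαm0 : (αm : ℂ) ≠ 0 := Complex.ofReal_ne_zero.2 hαm.ne'
  have hαg0 : (αg : ℂ) ≠ 0 := Complex.ofReal_ne_zero.2 hαg.ne'
  have hq := Gamma_quotient_eq (a := a) (s := s) (by simp [hs, h1]) (by simp [hs, h2])
  have hpow : ∀ (c β : ℝ) (w : ℂ), 0 < c → 0 < β → ((c * β / S : ℝ) : ℂ) ^ w
      = (c : ℂ) ^ w * (β : ℂ) ^ w * (S : ℂ) ^ (-w) := fun c β w hc hβ => by
    rw [div_eq_mul_inv, Complex.ofReal_mul, Complex.mul_cpow_ofReal_nonneg (by positivity)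
      (by positivity), Complex.ofReal_mul, Complex.mul_cpow_ofReal_nonneg hc.le hβ.le,
      Complex.ofReal_inv, Complex.inv_cpow_eq_ite, if_neg, ← Complex.cpow_neg]
    rw [Complex.arg_ofReal_of_nonneg hS.le]; exact Real.pi_pos.ne
  have e1 : (((σ₁ - a : ℝ) : ℂ) + u * Complex.I) = s - a := by rw [hs]; push_cast; ring
  have e2 : (((σ₂ - b : ℝ) : ℂ) + v * Complex.I) = t - b := by rw [ht]; push_cast; ring
  have e3 : (((σ₁ - a) + (σ₂ - b) : ℝ) : ℂ) + ((u + v : ℝ) : ℂ) * Complex.I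
      = 1 - (1 + a + b) + s + t := by
    rw [hs, ht]; push_cast; ring
  have e4 : -(((σ₁ - a) + (σ₂ - b) : ℝ) : ℂ) + ((-(u + v) : ℝ) : ℂ) * Complex.I
      = ((a : ℂ) + b) + (-s + -t) := by
    rw [hs, ht]; push_cast; ring
  simp only [signalFactor, jammingFactor, lineFactor]
  rw [e1, e2, e3, e4, ← hs, ← ht, miIntegrand, foxIntegrand, hpow c₁ βm s hc₁ hβm,
    hpow c₂ βg t hc₂ hβg]
  have hker : foxKernel 2 2 [(1, 2 / αm), (a, 1), (1 + a, 1)] [(a, 1), (a, 1), (1 + a, 1)] s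
      = Complex.Gamma (((αm / 2 : ℝ) : ℂ)⁻¹ * s) * -Complex.Gamma ((a : ℂ) - s) := by
    rw [← hq]
    simp [foxKernel]
    ring
  have hker2 : foxKernel 1 1 [(1, 2 / αg)] [(b, 1)] t
      = Complex.Gamma (((αg / 2 : ℝ) : ℂ)⁻¹ * t) * Complex.Gamma ((b : ℂ) - t) := by
    simp [foxKernel]
  have hker3 : foxJointKernel 1 [(1 + a + b, 1, 1)] [] s t
      = Complex.Gamma (1 - (1 + a + b) + s + t) := by
    simp [foxJointKernel]
  rw [hker, hker2, hker3, Complex.cpow_sub _ _ hc10, Complex.cpow_sub _ _ hc20,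
    Complex.cpow_add ((a : ℂ) + b) _ hS0, Complex.cpow_add (-s) _ hS0]
  have hSS : ((S ^ (-(a + b)) : ℝ) : ℂ) * (S : ℂ) ^ ((a : ℂ) + b) = 1 := by
    rw [Complex.ofReal_cpow hS.le, ← Complex.cpow_add _ _ hS0]
    push_cast
    simp
  have hc1a : (c₁ : ℂ) ^ (a : ℂ) ≠ 0 := by simp [Complex.cpow_eq_zero_iff, hc10]
  have hc2b : (c₂ : ℂ) ^ (b : ℂ) ≠ 0 := by simp [Complex.cpow_eq_zero_iff, hc20]
  simp only [Complex.ofReal_mul, Complex.ofReal_cpow hc₁.le, Complex.ofReal_cpow hc₂.le]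
  exact factor_rearrange (by simpa using hαm0) (by simpa using hαg0) hc1a hc2b hSS

lemma integrable_miIntegrand {αm αg a b βm βg c₁ c₂ S σ₁ σ₂ : ℝ} (hαm : 0 < αm) (hαg : 0 < αg)
    (ha : 0 < a) (hβm : 0 < βm) (hβg : 0 < βg) (hc₁ : 0 < c₁) (hc₂ : 0 < c₂) (hS : 0 < S)
    (hσ : IsContour a b σ₁ σ₂) :
    Integrable fun y : ℝ × ℝ => miIntegrand αm αg a b (c₁ * βm / S) (c₂ * βg / S)
      ((σ₁ : ℂ) + (y.1 : ℂ) * Complex.I) ((σ₂ : ℂ) + (y.2 : ℂ) * Complex.I) := by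
  obtain ⟨h1, h2, h3, h4, h5⟩ := hσ
  simp_rw [miIntegrand_eq hαm hαg hβm hβg hc₁ hc₂ hS h1 h2]
  exact (integrable_mul_Gamma_mul_cpow
    (integrable_signalFactor (by positivity) hβm hc₁ (ha.trans h1) h1 h2)
    (integrable_jammingFactor (by positivity) hβg hc₂ h3 h4) (by linarith) hS).const_mul _

lemma miFoxH_eq {αm αg a b βm βg c₁ c₂ S σ₁ σ₂ : ℝ} (hαm : 0 < αm) (hαg : 0 < αg)
    (ha : 0 < a) (hβm : 0 < βm) (hβg : 0 < βg) (hc₁ : 0 < c₁) (hc₂ : 0 < c₂) (hS : 0 < S)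
    (hσ : IsContour a b σ₁ σ₂) :
    miFoxH σ₁ σ₂ αm αg a b (c₁ * βm / S) (c₂ * βg / S)
      = (1 / (2 * Real.pi)) ^ 2
        * ((αm / 2 * (αg / 2) * c₁ ^ a * c₂ ^ b * S ^ (-(a + b)) : ℝ) : ℂ)
        * ∫ r in Ioi (0 : ℝ), ((r⁻¹ * Real.exp (-(S * r)) : ℝ) : ℂ)
          * ((∫ u : ℝ, signalFactor (αm / 2) βm c₁ σ₁ a u
              * (r : ℂ) ^ (((σ₁ - a : ℝ) : ℂ) + u * Complex.I))
            * ∫ v : ℝ, jammingFactor (αg / 2) βg c₂ σ₂ b v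
              * (r : ℂ) ^ (((σ₂ - b : ℝ) : ℂ) + v * Complex.I)) := by
  obtain ⟨h1, h2, h3, h4, h5⟩ := hσ
  rw [integral_exp_neg_mul_integral_mul_integral
    (integrable_signalFactor (by positivity) hβm hc₁ (ha.trans h1) h1 h2)
    (integrable_jammingFactor (by positivity) hβg hc₂ h3 h4) (by linarith) hS]
  have hI := Complex.I_sq
  have hf : miFoxH σ₁ σ₂ αm αg a b (c₁ * βm / S) (c₂ * βg / S)
      = (1 / (2 * (Real.pi : ℂ) * Complex.I)) ^ 2 * ∫ u : ℝ, ∫ v : ℝ,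
        miIntegrand αm αg a b (c₁ * βm / S) (c₂ * βg / S)
          ((σ₁ : ℂ) + (u : ℂ) * Complex.I) ((σ₂ : ℂ) + (v : ℂ) * Complex.I)
          * Complex.I * Complex.I := rfl
  simp_rw [hf, miIntegrand_eq hαm hαg hβm hβg hc₁ hc₂ hS h1 h2, mul_assoc _ Complex.I Complex.I,
    integral_mul_const, integral_const_mul]
  have hπ : (Real.pi : ℂ) ≠ 0 := Complex.ofReal_ne_zero.2 Real.pi_pos.ne'
  -- The factors i from ds = i du and dt = i dv cancel the i² in (2πi)².
  rw [one_div_pow, one_div_pow, mul_pow _ Complex.I, hI, ← sq, hI]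
  ring

/-! ### The expected rate on one sub-carrier -/

section Rate

variable {Ω : Type*} [MeasurableSpace Ω] {P : Measure Ω}
  {X Y : Ω → ℝ} {αm μm γm αg μg γg c₁ c₂ S : ℝ}

/-- Since log(1 + y) ≤ y and the denominator is at least S, the finite mean of X dominates. -/
lemma integrable_log_one_add_div (hαm : 0 < αm) (hμm : 0 < μm) (hγm : 0 < γm)
    (hX : HasLaw X (alphaMuLaw αm μm γm) P) (hY : AEMeasurable Y P) (hX0 : ∀ ω, 0 ≤ X ω)
    (hY0 : ∀ ω, 0 ≤ Y ω) (hc₁ : 0 < c₁) (hc₂ : 0 < c₂) (hS : 0 < S) :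
    Integrable (fun ω => Real.log (1 + c₁ * X ω / (S + c₂ * Y ω))) P := by
  have hXint : Integrable X P := by
    have h := integrable_id_alphaMuLaw hαm hμm hγm
    rw [← hX.map_eq] at h
    exact h.comp_aemeasurable hX.aemeasurable
  refine Integrable.mono' (hXint.const_mul (c₁ / S)) ?_ (ae_of_all _ fun ω => ?_)
  · have := hX.aemeasurable
    exact AEMeasurable.aestronglyMeasurable (by fun_prop)
  · have hx := hX0 ω
    have hy := hY0 ω
    have h0 : 0 ≤ c₁ * X ω / (S + c₂ * Y ω) := by positivity
    rw [Real.norm_of_nonneg (Real.log_nonneg (by linarith))]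
    calc Real.log (1 + c₁ * X ω / (S + c₂ * Y ω)) ≤ c₁ * X ω / (S + c₂ * Y ω) := by
          linarith [Real.log_le_sub_one_of_pos (by linarith : 0 < 1 + c₁ * X ω / (S + c₂ * Y ω))]
      _ ≤ c₁ * X ω / S := by
          gcongr
          have : 0 ≤ c₂ * Y ω := by positivity
          linarith
      _ = c₁ / S * X ω := by ring

lemma integral_log_one_add_div [IsProbabilityMeasure P] (hαm : 0 < αm) (hμm : 0 < μm) (hγm : 0 < γm)
    (hX : HasLaw X (alphaMuLaw αm μm γm) P) (hY : AEMeasurable Y P) (hX0 : ∀ ω, 0 ≤ X ω)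
    (hY0 : ∀ ω, 0 ≤ Y ω) (hXY : IndepFun X Y P) (hc₁ : 0 < c₁) (hc₂ : 0 < c₂) (hS : 0 < S) :
    ∫ ω, Real.log (1 + c₁ * X ω / (S + c₂ * Y ω)) ∂P
      = ∫ r in Ioi (0 : ℝ), r⁻¹ * Real.exp (-(S * r))
        * ((∫ ω, (1 - Real.exp (-(c₁ * r * X ω))) ∂P)
          * ∫ ω, Real.exp (-(c₂ * r * Y ω)) ∂P) := by
  have hXm := hX.aemeasurable
  have hlog := integrable_log_one_add_div hαm hμm hγm hX hY hX0 hY0 hc₁ hc₂ hS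
  set F : Ω → ℝ → ℝ := fun ω r =>
    r⁻¹ * ((1 - Real.exp (-(c₁ * X ω * r))) * Real.exp (-((S + c₂ * Y ω) * r))) with hF
  have hA : ∀ ω, 0 ≤ c₁ * X ω := fun ω => mul_nonneg hc₁.le (hX0 ω)
  have hB : ∀ ω, 0 < S + c₂ * Y ω := fun ω => by
    have := mul_nonneg hc₂.le (hY0 ω)
    linarith
  -- By nonnegativity the L¹ norm in r is the logarithm itself, so the Fubini condition is exactly
  -- its integrability.
  have hnorm : ∀ ω, ∫ r in Ioi (0 : ℝ), ‖F ω r‖ = Real.log (1 + c₁ * X ω / (S + c₂ * Y ω)) :=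
    fun ω => by
      rw [← integral_inv_mul_one_sub_exp_mul_exp (hA ω) (hB ω)]
      refine setIntegral_congr_fun measurableSet_Ioi fun r hr => ?_
      have hr : 0 < r := hr
      have h0 := one_sub_exp_neg_nonneg (mul_nonneg (hA ω) hr.le)
      exact Real.norm_of_nonneg (by positivity)
  have hFint : Integrable (Function.uncurry F) (P.prod (volume.restrict (Ioi 0))) := by
    rw [integrable_prod_iff]
    · refine ⟨ae_of_all _ fun ω => integrableOn_inv_mul_one_sub_exp_mul_exp (hA ω) (hB ω), ?_⟩
      refine hlog.congr (ae_of_all _ fun ω => (hnorm ω).symm)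
    · have h1 : AEMeasurable (fun z : Ω × ℝ => X z.1) (P.prod (volume.restrict (Ioi 0))) :=
        hXm.comp_fst
      have h2 : AEMeasurable (fun z : Ω × ℝ => Y z.1) (P.prod (volume.restrict (Ioi 0))) :=
        hY.comp_fst
      refine AEMeasurable.aestronglyMeasurable ?_
      simp only [Function.uncurry_def, hF]
      fun_prop
  calc _ = ∫ ω, (∫ r in Ioi (0 : ℝ), F ω r) ∂P := by
        refine integral_congr_ae (ae_of_all _ fun ω => ?_)
        exact (integral_inv_mul_one_sub_exp_mul_exp (hA ω) (hB ω)).symm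
    _ = ∫ r in Ioi (0 : ℝ), ∫ ω, F ω r ∂P := integral_integral_swap hFint
    _ = _ := by
        refine integral_congr_ae (ae_of_all _ fun r => ?_)
        simp only
        -- Independence enters here: for fixed r, the integrand is a function of X times a function
        -- of Y.
        rw [← hXY.integral_fun_comp_mul_comp (f := fun x => 1 - Real.exp (-(c₁ * r * x)))
          (g := fun y => Real.exp (-(c₂ * r * y))) hXm hY
          (Measurable.aestronglyMeasurable (by fun_prop))
          (Measurable.aestronglyMeasurable (by fun_prop)), ← integral_const_mul]
        refine integral_congr_ae (ae_of_all _ fun ω => ?_)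
        simp only [hF]
        rw [mul_right_comm c₁, mul_right_comm c₂, add_mul, neg_add, Real.exp_add]
        ring

/-- The strip -1 < a - σ < 0 on which 1 - e^(-x) has transform -Γ is the contour condition a < σ < a
+ 1. -/
lemma integral_one_sub_exp_neg_eq {σ : ℝ} (hαm : 0 < αm) (hμm : 0 < μm) (hγm : 0 < γm)
    (hX : HasLaw X (alphaMuLaw αm μm γm) P) (hc₁ : 0 < c₁) (h1 : αm * μm / 2 < σ)
    (h2 : σ < αm * μm / 2 + 1) {r : ℝ} (hr : 0 < r) :
    ((∫ ω, (1 - Real.exp (-(c₁ * r * X ω))) ∂P : ℝ) : ℂ)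
      = ((αm / (2 * alphaMuScale αm μm γm ^ (αm * μm / 2) * Real.Gamma μm) : ℝ) : ℂ)
        * (1 / (2 * Real.pi) * ∫ u : ℝ,
          signalFactor (αm / 2) (alphaMuScale αm μm γm) c₁ σ (αm * μm / 2) u
            * (r : ℂ) ^ (((σ - αm * μm / 2 : ℝ) : ℂ) + u * Complex.I)) := by
  have ha : 0 < αm * μm / 2 := by positivity
  rw [signalFactor, ← integral_rpow_mul_exp_neg_rpow_mul_comp
    (g := fun x : ℝ => ((1 - Real.exp (-x) : ℝ) : ℂ)) (by positivity)
    (alphaMuScale_pos hαm hμm hγm) hc₁ (ha.trans h1)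
    (fun w hw => hasMellin_one_sub_exp_neg (by linarith) (by linarith)) hr,
    ← integral_alphaMuLaw hαm hμm hγm, ← integral_complex_ofReal]
  exact hX.integral_comp (f := fun x => ((1 - Real.exp (-(c₁ * r * x)) : ℝ) : ℂ))
    (Measurable.aestronglyMeasurable (by fun_prop))

lemma integral_exp_neg_eq {σ : ℝ} (hαg : 0 < αg) (hμg : 0 < μg) (hγg : 0 < γg)
    (hY : HasLaw Y (alphaMuLaw αg μg γg) P) (hc₂ : 0 < c₂) (h1 : 0 < σ)
    (h2 : σ < αg * μg / 2) {r : ℝ} (hr : 0 < r) :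
    ((∫ ω, Real.exp (-(c₂ * r * Y ω)) ∂P : ℝ) : ℂ)
      = ((αg / (2 * alphaMuScale αg μg γg ^ (αg * μg / 2) * Real.Gamma μg) : ℝ) : ℂ)
        * (1 / (2 * Real.pi) * ∫ v : ℝ,
          jammingFactor (αg / 2) (alphaMuScale αg μg γg) c₂ σ (αg * μg / 2) v
            * (r : ℂ) ^ (((σ - αg * μg / 2 : ℝ) : ℂ) + v * Complex.I)) := by
  rw [jammingFactor, ← integral_rpow_mul_exp_neg_rpow_mul_comp
    (g := fun x : ℝ => (Real.exp (-x) : ℂ)) (by positivity)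
    (alphaMuScale_pos hαg hμg hγg) hc₂ h1
    (fun w hw => hasMellin_exp_neg (by linarith)) hr,
    ← integral_alphaMuLaw hαg hμg hγg, ← integral_complex_ofReal]
  exact hY.integral_comp (f := fun x => (Real.exp (-(c₂ * r * x)) : ℂ))
    (Measurable.aestronglyMeasurable (by fun_prop))

/-- The closed form of the expected logarithmic rate on one sub-carrier. -/
theorem integral_log_one_add_div_eq_miFoxH [IsProbabilityMeasure P] {σ₁ σ₂ : ℝ} (hαm : 0 < αm) (hμm : 0 < μm)
    (hγm : 0 < γm) (hαg : 0 < αg) (hμg : 0 < μg) (hγg : 0 < γg)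
    (hX : HasLaw X (alphaMuLaw αm μm γm) P) (hY : HasLaw Y (alphaMuLaw αg μg γg) P)
    (hX0 : ∀ ω, 0 ≤ X ω) (hY0 : ∀ ω, 0 ≤ Y ω) (hXY : IndepFun X Y P)
    (hc₁ : 0 < c₁) (hc₂ : 0 < c₂) (hS : 0 < S)
    (hσ : IsContour (αm * μm / 2) (αg * μg / 2) σ₁ σ₂) :
    ((∫ ω, Real.log (1 + c₁ * X ω / (S + c₂ * Y ω)) ∂P : ℝ) : ℂ)
      = ((((c₂ * alphaMuScale αg μg γg) ^ (αg * μg / 2) * Real.Gamma μg)⁻¹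
          / ((c₁ * alphaMuScale αm μm γm) ^ (αm * μm / 2) * Real.Gamma μm)
          * S ^ (αm * μm / 2 + αg * μg / 2) : ℝ) : ℂ)
        * miFoxH σ₁ σ₂ αm αg (αm * μm / 2) (αg * μg / 2)
            (c₁ * alphaMuScale αm μm γm / S) (c₂ * alphaMuScale αg μg γg / S) := by
  have hβm := alphaMuScale_pos hαm hμm hγm
  have hβg := alphaMuScale_pos hαg hμg hγg
  rw [miFoxH_eq hαm hαg (by positivity) hβm hβg hc₁ hc₂ hS hσ]
  obtain ⟨h1, h2, h3, h4, h5⟩ := hσ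
  rw [integral_log_one_add_div hαm hμm hγm hX hY.aemeasurable hX0 hY0 hXY hc₁ hc₂ hS,
    ← integral_complex_ofReal, ← mul_assoc, ← integral_const_mul]
  refine setIntegral_congr_fun measurableSet_Ioi fun r hr => ?_
  rw [Complex.ofReal_mul, Complex.ofReal_mul (∫ ω, _ ∂P),
    integral_one_sub_exp_neg_eq hαm hμm hγm hX hc₁ h1 h2 hr,
    integral_exp_neg_eq hαg hμg hγg hY hc₂ h3 h4 hr]
  -- The product of the two density normalizations equals the prefactor of the closed form times the
  -- constant of `miFoxH_eq`; the powers of S, c₁ and c₂ cancel.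
  have hcoef : αm / (2 * alphaMuScale αm μm γm ^ (αm * μm / 2) * Real.Gamma μm)
      * (αg / (2 * alphaMuScale αg μg γg ^ (αg * μg / 2) * Real.Gamma μg))
      = (((c₂ * alphaMuScale αg μg γg) ^ (αg * μg / 2) * Real.Gamma μg)⁻¹
          / ((c₁ * alphaMuScale αm μm γm) ^ (αm * μm / 2) * Real.Gamma μm)
          * S ^ (αm * μm / 2 + αg * μg / 2))
        * (αm / 2 * (αg / 2) * c₁ ^ (αm * μm / 2) * c₂ ^ (αg * μg / 2)
          * S ^ (-(αm * μm / 2 + αg * μg / 2))) := by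
    rw [Real.mul_rpow hc₂.le hβg.le, Real.mul_rpow hc₁.le hβm.le, Real.rpow_neg hS.le]
    have := Real.Gamma_pos_of_pos hμm
    have := Real.Gamma_pos_of_pos hμg
    have := Real.rpow_pos_of_pos hc₁ (αm * μm / 2)
    have := Real.rpow_pos_of_pos hc₂ (αg * μg / 2)
    have := Real.rpow_pos_of_pos hβm (αm * μm / 2)
    have := Real.rpow_pos_of_pos hβg (αg * μg / 2)
    have := Real.rpow_pos_of_pos hS (αm * μm / 2 + αg * μg / 2)
    generalize c₁ ^ (αm * μm / 2) = x₁ at *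
    generalize c₂ ^ (αg * μg / 2) = x₂ at *
    generalize alphaMuScale αm μm γm ^ (αm * μm / 2) = x₃ at *
    generalize alphaMuScale αg μg γg ^ (αg * μg / 2) = x₄ at *
    generalize S ^ (αm * μm / 2 + αg * μg / 2) = x₅ at *
    field_simp
  have hcoef' := congrArg Complex.ofReal hcoef
  rw [Complex.ofReal_mul, Complex.ofReal_mul (_ / _ * _)] at hcoef'
  generalize (∫ u : ℝ, signalFactor _ _ _ _ _ u * _) = I₁
  generalize (∫ u : ℝ, jammingFactor _ _ _ _ _ u * _) = I₂
  linear_combination ((r⁻¹ * Real.exp (-(S * r)) : ℝ) : ℂ) * (1 / (2 * Real.pi)) ^ 2 * I₁ * I₂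
    * hcoef'

end Rate

/-! ### Existence of integration paths and the rate of the whole channel -/

lemma exists_isContour (a : ℝ) {b : ℝ} (hb : 0 < b) : ∃ σ₁ σ₂ : ℝ, IsContour a b σ₁ σ₂ := by
  have h : 0 < min 1 b := lt_min one_pos hb
  have h1 := min_le_left 1 b
  have h2 := min_le_right 1 b
  -- With ε = min(1, b), σ₁ exceeds a by ε/2 while σ₂ falls short of b by only ε/4, so the sum
  -- exceeds a + b by ε/4.
  exact ⟨a + min 1 b / 2, b - min 1 b / 4, by linarith, by linarith, by linarith, by linarith,
    by linarith⟩

end CovertRadar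

theorem theorem3
    {Ω : Type*} [MeasurableSpace Ω] (P : Measure Ω) [IsProbabilityMeasure P]
    -- sub-carriers, pulse duration and duty factor
    (Mc : ℕ) (fc Δf Tpulse δ : ℝ) (hTpulse : 0 < Tpulse) (hδ : 0 < δ)
    -- locations of the receiver, the node and the jammer, and path loss exponents
    (qb qi qg : EuclideanSpace ℝ (Fin 3)) (hbi : qb ≠ qi) (hgi : qg ≠ qi) (κbi κgi : ℝ)
    -- transmit powers, jamming power, noise power
    (pT : ℕ → ℝ) (hpT : ∀ m ∈ Finset.Icc 1 Mc, 0 < pT m) (pJ : ℝ) (hpJ : 0 < pJ)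
    (σr : ℝ) (hσr : 0 < σr)
    (Ψ : ℝ → ℝ) (hΨ : ∀ m ∈ Finset.Icc 1 Mc, Ψ (CovertRadar.subcarrier fc Δf m) = σr ^ 2)
    -- parameters of the distributions of the energy spectral densities
    (αrm μrm γrm : ℕ → ℝ)
    (hαrm : ∀ m ∈ Finset.Icc 1 Mc, 0 < αrm m) (hμrm : ∀ m ∈ Finset.Icc 1 Mc, 0 < μrm m)
    (hγrm : ∀ m ∈ Finset.Icc 1 Mc, 0 < γrm m)
    (αrg μrg γrg : ℝ) (hαrg : 0 < αrg) (hμrg : 0 < μrg) (hγrg : 0 < γrg)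
    -- random spectra of the transmitted and of the jamming signal
    (G J : Ω → ℝ → ℂ)
    (hG : ∀ m ∈ Finset.Icc 1 Mc,
      HasLaw (fun ω => ‖G ω (CovertRadar.subcarrier fc Δf m)‖ ^ 2)
        (CovertRadar.alphaMuLaw (αrm m) (μrm m) (γrm m)) P)
    (hJ : ∀ m ∈ Finset.Icc 1 Mc,
      HasLaw (fun ω => ‖J ω (CovertRadar.subcarrier fc Δf m)‖ ^ 2)
        (CovertRadar.alphaMuLaw αrg μrg γrg) P)
    (hGJ : ∀ m ∈ Finset.Icc 1 Mc,
      IndepFun (fun ω => ‖G ω (CovertRadar.subcarrier fc Δf m)‖ ^ 2)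
        (fun ω => ‖J ω (CovertRadar.subcarrier fc Δf m)‖ ^ 2) P)
    -- abbreviations
    (Tpri : ℝ) (hTpri : Tpri = Tpulse / δ)
    (C₃ : ℕ → ℝ) (hC₃ : ∀ m, C₃ m = Tpri * CovertRadar.pathLoss qb qi κbi * pT m)
    (C₄ : ℝ) (hC₄ : C₄ = CovertRadar.pathLoss qg qi κgi * pJ)
    (βrm : ℕ → ℝ) (hβrm : ∀ m, βrm m = CovertRadar.alphaMuScale (αrm m) (μrm m) (γrm m))
    (βrg : ℝ) (hβrg : βrg = CovertRadar.alphaMuScale αrg μrg γrg) :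
    -- the expected rate exists
    Integrable (fun ω => CovertRadar.mutualInfo Mc fc Δf Tpri
      (CovertRadar.pathLoss qb qi κbi) (CovertRadar.pathLoss qg qi κgi) pT pJ Ψ (G ω) (J ω)) P ∧
    -- integration paths exist
    (∀ m ∈ Finset.Icc 1 Mc, ∃ σ₁ σ₂ : ℝ,
      CovertRadar.IsContour (αrm m * μrm m / 2) (αrg * μrg / 2) σ₁ σ₂) ∧
    -- for all of them the H-functions converge absolutely and give the rate
    ∀ σ₁ σ₂ : ℕ → ℝ,
      (∀ m ∈ Finset.Icc 1 Mc,
        CovertRadar.IsContour (αrm m * μrm m / 2) (αrg * μrg / 2) (σ₁ m) (σ₂ m)) →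
      (∀ m ∈ Finset.Icc 1 Mc, Integrable (fun y : ℝ × ℝ =>
        CovertRadar.miIntegrand (αrm m) αrg (αrm m * μrm m / 2) (αrg * μrg / 2)
          (C₃ m * βrm m / σr ^ 2) (C₄ * βrg / σr ^ 2)
          ((σ₁ m : ℂ) + (y.1 : ℂ) * Complex.I) ((σ₂ m : ℂ) + (y.2 : ℂ) * Complex.I))) ∧
      (((∫ ω, CovertRadar.mutualInfo Mc fc Δf Tpri
          (CovertRadar.pathLoss qb qi κbi) (CovertRadar.pathLoss qg qi κgi)
          pT pJ Ψ (G ω) (J ω) ∂P : ℝ)) : ℂ) =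
        ∑ m ∈ Finset.Icc 1 Mc,
          ((Δf * Tpri / Real.log 2
            * ((2 * (C₄ * βrg) ^ (αrg * μrg / 2) * Real.Gamma μrg)⁻¹
              / ((C₃ m * βrm m) ^ (αrm m * μrm m / 2) * Real.Gamma (μrm m)))
            * (σr ^ 2) ^ (αrm m * μrm m / 2 + αrg * μrg / 2) : ℝ) : ℂ)
          * CovertRadar.miFoxH (σ₁ m) (σ₂ m) (αrm m) αrg (αrm m * μrm m / 2) (αrg * μrg / 2)
              (C₃ m * βrm m / σr ^ 2) (C₄ * βrg / σr ^ 2) := by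
  have hT : 0 < Tpri := hTpri ▸ div_pos hTpulse hδ
  have hLb : 0 < CovertRadar.pathLoss qb qi κbi := Real.rpow_pos_of_pos (dist_pos.2 hbi) _
  have hLg : 0 < CovertRadar.pathLoss qg qi κgi := Real.rpow_pos_of_pos (dist_pos.2 hgi) _
  have hC₃' : ∀ m ∈ Finset.Icc 1 Mc, 0 < C₃ m := fun m hm => by
    rw [hC₃]
    exact mul_pos (mul_pos hT hLb) (hpT m hm)
  have hC₄' : 0 < C₄ := hC₄ ▸ mul_pos hLg hpJ
  have hS : 0 < σr ^ 2 := by positivity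
  have hrate : ∀ ω, CovertRadar.mutualInfo Mc fc Δf Tpri
      (CovertRadar.pathLoss qb qi κbi) (CovertRadar.pathLoss qg qi κgi) pT pJ Ψ (G ω) (J ω)
      = ∑ m ∈ Finset.Icc 1 Mc, Δf * Tpri / 2 / Real.log 2
        * Real.log (1 + C₃ m * ‖G ω (CovertRadar.subcarrier fc Δf m)‖ ^ 2
          / (σr ^ 2 + C₄ * ‖J ω (CovertRadar.subcarrier fc Δf m)‖ ^ 2)) := fun ω => by
    rw [CovertRadar.mutualInfo, Finset.mul_sum]
    refine Finset.sum_congr rfl fun m hm => ?_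
    rw [hΨ m hm, hC₃, hC₄, Real.logb]
    ring
  have hint : ∀ m ∈ Finset.Icc 1 Mc, Integrable (fun ω => Δf * Tpri / 2 / Real.log 2
        * Real.log (1 + C₃ m * ‖G ω (CovertRadar.subcarrier fc Δf m)‖ ^ 2
          / (σr ^ 2 + C₄ * ‖J ω (CovertRadar.subcarrier fc Δf m)‖ ^ 2))) P := fun m hm =>
    (CovertRadar.integrable_log_one_add_div (hαrm m hm) (hμrm m hm) (hγrm m hm) (hG m hm)
      (hJ m hm).aemeasurable (fun ω => by positivity) (fun ω => by positivity) (hC₃' m hm)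
      hC₄' hS).const_mul _
  simp_rw [hrate]
  refine ⟨integrable_finsetSum _ hint, fun m _ =>
    CovertRadar.exists_isContour _ (by positivity), fun σ₁ σ₂ hσ => ⟨fun m hm => ?_, ?_⟩⟩
  · have h1 := hαrm m hm
    have h2 := hμrm m hm
    exact CovertRadar.integrable_miIntegrand h1 hαrg (by positivity)
      (hβrm m ▸ CovertRadar.alphaMuScale_pos h1 h2 (hγrm m hm))
      (hβrg ▸ CovertRadar.alphaMuScale_pos hαrg hμrg hγrg) (hC₃' m hm) hC₄' hS (hσ m hm)
  · rw [integral_finsetSum _ hint, Complex.ofReal_sum]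
    refine Finset.sum_congr rfl fun m hm => ?_
    rw [integral_const_mul, Complex.ofReal_mul,
      CovertRadar.integral_log_one_add_div_eq_miFoxH (hαrm m hm) (hμrm m hm) (hγrm m hm) hαrg hμrg
        hγrg (hG m hm) (hJ m hm) (fun ω => by positivity) (fun ω => by positivity) (hGJ m hm)
        (hC₃' m hm) hC₄' hS (hσ m hm), ← hβrm, ← hβrg, ← mul_assoc, ← Complex.ofReal_mul]
    congr 2
    -- The 1/2 of Δf·T/2 is the factor 2 inside the inverse (2 (C₄ β_rg)^b Γ(μ_rg))⁻¹.
    rw [mul_assoc (2 : ℝ), mul_inv (2 : ℝ)]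
    ring
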